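/- Let $Q\in\mathbb{Q}[x,y]$ be a polynomial of total degree $2$. Then at least one of the following holds: 1. $\#\big(Q(\mathbb{Z}^2)\cap[N,2N]\big)\ll \dfrac{N}{\sqrt{\log N}}$, i.e. there are constants $C>0$ and $N_0\ge 2$, depending only on $Q$, such that $\#\big(Q(\mathbb{Z}^2)\cap[N,2N]\big)\le C\,N/\sqrt{\log N}$ for all integers $N\ge N_0$; 2. $\displaystyle\inf_{(x,y)\in\mathbb{Z}^2}Q(x,y)=-\infty$. In particular, $Q(\mathbb{Z}^2)\neq\mathbb{Z}_{\ge 0}$. Here $Q(\mathbb{Z}^2)=\{Q(x,y):(x,y)\in\mathbb{Z}^2\}$ is the set of values (counted without multiplicity). -/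

import Mathlib

open Filter Asymptotics

/-- The value `F(x, y)`, as a real number, of `F ∈ ℚ[x, y]` at the integer point `p = (x, y)`. -/
noncomputable def valueAt (F : MvPolynomial (Fin 2) ℚ) (p : ℤ × ℤ) : ℝ :=
  ((MvPolynomial.eval ![(p.1 : ℚ), (p.2 : ℚ)] F : ℚ) : ℝ)

/-- The value set `F(ℤ²)`. -/
def valueSet (F : MvPolynomial (Fin 2) ℚ) : Set ℝ :=
  Set.range (valueAt F)

/-- `F(ℤ²) ∩ B`, the set of values of `F` at integer points that lie in the set `B` of reals. -/
def valuesIn (F : MvPolynomial (Fin 2) ℚ) (B : Set ℝ) : Set ℝ :=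
  valueSet F ∩ B

/-- The values of `F` at integer points have a common denominator. -/
theorem exists_common_denominator (F : MvPolynomial (Fin 2) ℚ) :
    ∃ d : ℕ, 0 < d ∧ ∀ p : ℤ × ℤ, ∃ m : ℤ, (d : ℝ) * valueAt F p = m := by
  induction F using MvPolynomial.induction_on with
  | C a =>
    refine ⟨a.den, a.den_pos, fun p => ⟨a.num, ?_⟩⟩
    have h : (a.den : ℚ) * a = a.num := Rat.den_mul_eq_num a
    simp only [valueAt, MvPolynomial.eval_C]
    exact_mod_cast h
  | add f g hf hg =>
    obtain ⟨d, hd, hf⟩ := hf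
    obtain ⟨e, he, hg⟩ := hg
    refine ⟨d * e, Nat.mul_pos hd he, fun p => ?_⟩
    obtain ⟨m, hm⟩ := hf p
    obtain ⟨n, hn⟩ := hg p
    refine ⟨e * m + d * n, ?_⟩
    have h : valueAt (f + g) p = valueAt f p + valueAt g p := by simp [valueAt]
    push_cast
    rw [h, ← hm, ← hn]
    ring
  | mul_X f i hf =>
    obtain ⟨d, hd, hf⟩ := hf
    refine ⟨d, hd, fun p => ?_⟩
    obtain ⟨m, hm⟩ := hf p
    fin_cases i
    · exact ⟨m * p.1, by push_cast; rw [← hm]; simp [valueAt, mul_assoc]⟩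
    · exact ⟨m * p.2, by push_cast; rw [← hm]; simp [valueAt, mul_assoc]⟩

/-- Only finitely many values of `F` lie in a bounded interval, so that `Set.ncard` below
is the true number of elements. -/
theorem valuesIn_Icc_finite (F : MvPolynomial (Fin 2) ℚ) (a b : ℝ) :
    (valuesIn F (Set.Icc a b)).Finite := by
  obtain ⟨d, hd, h⟩ := exists_common_denominator F
  have hd' : (0 : ℝ) < d := by exact_mod_cast hd
  refine ((Set.finite_Icc ⌈(d : ℝ) * a⌉ ⌊(d : ℝ) * b⌋).image fun m : ℤ => (m : ℝ) / d).subset ?_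
  rintro _ ⟨⟨p, rfl⟩, h1, h2⟩
  obtain ⟨m, hm⟩ := h p
  refine ⟨m, ⟨Int.ceil_le.2 ?_, Int.le_floor.2 ?_⟩, ?_⟩
  · rw [← hm]; gcongr
  · rw [← hm]; gcongr
  · simp only; rw [← hm]; field_simp

/-! Completing the square shows that either `Q` tends to `-∞` along an integer line, or a positive
multiple of `Q` plus a constant has all its values of the form `u² + D v²` with `D > 0`
(`exists_sq_add_or_unbounded`). In the second case it suffices to count such values
(`exists_ncard_sq_add_le`). Each is `m² e r` with `e ∣ 4D` and `r` built from primes with `χ p = 1`,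
where `χ` is the quadratic character attached to `-D`. On these split numbers `1 * χ` is the divisor
function, so `(∑ r^(-s))² ≤ ζ(s) L(s, χ) ≪ 1/(s - 1)`. Hence `∑ 1/r ≪ √log x` over split `r ≤ x`,
and Chebyshev's bound for `ψ` turns this into `≪ x / √log x` split numbers. Only upper bounds are
used: neither `L(1, χ) ≠ 0` nor primes in progressions enter. -/

/-! ### The Dirichlet series of `1 * χ` near `s = 1`. -/

theorem DirichletCharacter.LSeries_zetaMul {q : ℕ} [NeZero q] (χ : DirichletCharacter ℂ q)
    {s : ℂ} (hs : 1 < s.re) : LSeries χ.zetaMul s = riemannZeta s * LFunction χ s := by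
  rw [zetaMul, ← ArithmeticFunction.coe_mul, LSeries_convolution', LFunction_eq_LSeries χ hs,
    ← ArithmeticFunction.LSeries_zeta_eq_riemannZeta hs]
  · congr 1
    exact (LSeries_congr χ.apply_eq_toArithmeticFunction_apply s).symm
  · exact ArithmeticFunction.LSeriesSummable_zeta_iff.mpr hs
  · exact (LSeriesSummable_congr _ fun h ↦ (χ.apply_eq_toArithmeticFunction_apply h).symm).mpr <|
      ZMod.LSeriesSummable_of_one_lt_re χ hs

/-- For a nontrivial quadratic character `χ`, the Dirichlet series with the non-negative coefficients
`1 * χ` is `O(1 / (s - 1))` as `s → 1⁺`. -/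
theorem DirichletCharacter.exists_tsum_re_term_zetaMul_le {q : ℕ} [NeZero q]
    {χ : DirichletCharacter ℂ q} (hχ : χ ≠ 1) :
    ∃ C : ℝ, 0 ≤ C ∧ ∀ s : ℝ, 1 < s → s ≤ 2 →
      ∑' n, (LSeries.term χ.zetaMul s n).re ≤ C / (s - 1) := by
  -- `G` is `(s - 1) ζ(s) L(s, χ)` with the singularity at `1` filled in, hence bounded on `[1, 2]`.
  let G : ℂ → ℂ := fun s => LFunctionTrivChar₁ 1 s * LFunction χ s
  have hG : Continuous fun s : ℝ => G s :=
    ((differentiable_LFunctionTrivChar₁ (n := 1)).continuous.mul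
      (differentiable_LFunction hχ).continuous).comp Complex.continuous_ofReal
  obtain ⟨C, hC⟩ := (isCompact_Icc (a := (1 : ℝ)) (b := 2)).exists_bound_of_continuousOn
    hG.continuousOn
  refine ⟨C, (norm_nonneg _).trans (hC 1 (by simp)), fun s h1 h2 => ?_⟩
  have hs : 1 < (s : ℂ).re := by simpa using h1
  have hs0 : 0 < s - 1 := by linarith
  have hne : (s : ℂ) ≠ 1 := by exact_mod_cast h1.ne'
  have key : G s = ((s - 1 : ℝ) : ℂ) * LSeries χ.zetaMul s := by
    rw [χ.LSeries_zetaMul hs]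
    simp only [G, LFunctionTrivChar₁, Function.update_of_ne hne, LFunctionTrivChar,
      LFunction_modOne_eq]
    push_cast
    ring
  have hre : ∑' n, (LSeries.term χ.zetaMul s n).re = (LSeries χ.zetaMul s).re := by
    rw [LSeries, Complex.re_tsum (χ.LSeriesSummable_zetaMul hs)]
  rw [hre, le_div_iff₀ hs0, mul_comm, ← Complex.re_ofReal_mul, ← key]
  exact (Complex.re_le_norm _).trans (hC s ⟨h1.le, h2⟩)

/-! ### Split numbers and their count. -/

/-- The positive integers all of whose divisors `d` satisfy `χ d = 1`. -/
def DirichletCharacter.splitNumbers {q : ℕ} (χ : DirichletCharacter ℂ q) : Set ℕ :=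
  {n | n ≠ 0 ∧ ∀ d, d ∣ n → χ d = 1}

namespace DirichletCharacter

variable {q : ℕ} {χ : DirichletCharacter ℂ q}

theorem mem_splitNumbers_of_dvd {m n : ℕ} (hn : n ∈ χ.splitNumbers) (h : m ∣ n) :
    m ∈ χ.splitNumbers :=
  ⟨ne_zero_of_dvd_ne_zero hn.1 h, fun d hd => hn.2 d (hd.trans h)⟩

theorem mul_mem_splitNumbers {m n : ℕ} (hm : m ∈ χ.splitNumbers) (hn : n ∈ χ.splitNumbers) :
    m * n ∈ χ.splitNumbers := by
  refine ⟨mul_ne_zero hm.1 hn.1, fun d hd => ?_⟩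
  obtain ⟨a, b, ha, hb, rfl⟩ := exists_dvd_and_dvd_of_dvd_mul hd
  simp [hm.2 a ha, hn.2 b hb]

theorem mem_splitNumbers_of_primes {n : ℕ} (hn : n ≠ 0)
    (h : ∀ p : ℕ, p.Prime → p ∣ n → χ p = 1) : n ∈ χ.splitNumbers := by
  induction n using Nat.recOnMul with
  | zero => exact absurd rfl hn
  | one => exact ⟨one_ne_zero, fun d hd => by simp [Nat.dvd_one.1 hd]⟩
  | prime p hp =>
    refine ⟨hn, fun d hd => ?_⟩
    rcases (Nat.dvd_prime hp).1 hd with rfl | rfl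
    · simp
    · exact h _ hp dvd_rfl
  | mul a b ha hb =>
    exact mul_mem_splitNumbers
      (ha (left_ne_zero_of_mul hn) fun p hp hpa => h p hp (hpa.mul_right b))
      (hb (right_ne_zero_of_mul hn) fun p hp hpb => h p hp (hpb.mul_left a))

theorem zetaMul_eq_card_divisors {n : ℕ} (hn : n ∈ χ.splitNumbers) :
    χ.zetaMul n = (n.divisors.card : ℂ) := by
  rw [zetaMul, ArithmeticFunction.coe_zeta_mul_apply, Finset.card_eq_sum_ones, Nat.cast_sum]
  refine Finset.sum_congr rfl fun d hd => ?_
  have hd' := Nat.dvd_of_mem_divisors hd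
  simp [toArithmeticFunction, hn.2 d hd', ne_zero_of_dvd_ne_zero hn.1 hd']

open scoped ComplexOrder in
theorem re_term_zetaMul_nonneg (hχ : χ ^ 2 = 1) (s : ℝ) (n : ℕ) :
    0 ≤ (LSeries.term χ.zetaMul s n).re := by
  rcases eq_or_ne n 0 with rfl | hn
  · simp
  rw [LSeries.term_of_ne_zero hn, div_eq_mul_inv, ← Complex.ofReal_natCast,
    ← Complex.ofReal_cpow n.cast_nonneg, ← Complex.ofReal_inv, Complex.re_mul_ofReal]
  exact mul_nonneg (Complex.nonneg_iff.1 (zetaMul_nonneg hχ n)).1 (by positivity)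

theorem re_term_zetaMul_of_mem {n : ℕ} (hn : n ∈ χ.splitNumbers) (s : ℝ) :
    (LSeries.term χ.zetaMul s n).re = n.divisors.card * (n : ℝ) ^ (-s) := by
  rw [LSeries.term_of_ne_zero hn.1, div_eq_mul_inv, ← Complex.ofReal_natCast,
    ← Complex.ofReal_cpow n.cast_nonneg, ← Complex.ofReal_inv, Complex.re_mul_ofReal,
    zetaMul_eq_card_divisors hn, Real.rpow_neg n.cast_nonneg]
  simp

/-- Expand the square: a product `n` is again split and comes from at most `d(n)` pairs, which is
its coefficient in `1 * χ`. The remaining coefficients are non-negative because `χ` is quadratic. -/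
theorem sq_sum_splitNumbers_le (hχ : χ ^ 2 = 1) (T : Finset ℕ) (hT : ∀ n ∈ T, n ∈ χ.splitNumbers)
    {s : ℝ} (hs : 1 < s) :
    (∑ n ∈ T, (n : ℝ) ^ (-s)) ^ 2 ≤ ∑' n, (LSeries.term χ.zetaMul s n).re := by
  have hsum : Summable fun n => (LSeries.term χ.zetaMul s n).re :=
    (Complex.hasSum_re (χ.LSeriesSummable_zetaMul (s := s) (by simpa using hs)).hasSum).summable
  calc (∑ n ∈ T, (n : ℝ) ^ (-s)) ^ 2
      = ∑ x ∈ T ×ˢ T, (((x.1 * x.2 : ℕ) : ℝ)) ^ (-s) := by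
        rw [sq, Finset.sum_mul_sum, Finset.sum_product]
        refine Finset.sum_congr rfl fun a _ => Finset.sum_congr rfl fun b _ => ?_
        rw [Nat.cast_mul, Real.mul_rpow a.cast_nonneg b.cast_nonneg]
    _ = ∑ n ∈ (T ×ˢ T).image fun x => x.1 * x.2,
          ((T ×ˢ T).filter fun x => x.1 * x.2 = n).card • ((n : ℝ) ^ (-s)) :=
        Finset.sum_comp (fun n : ℕ => (n : ℝ) ^ (-s)) fun x : ℕ × ℕ => x.1 * x.2
    _ ≤ ∑ n ∈ (T ×ˢ T).image fun x => x.1 * x.2, (LSeries.term χ.zetaMul s n).re := by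
        refine Finset.sum_le_sum fun n hn => ?_
        obtain ⟨x, hx, rfl⟩ := Finset.mem_image.1 hn
        rw [Finset.mem_product] at hx
        have hm := mul_mem_splitNumbers (hT _ hx.1) (hT _ hx.2)
        rw [re_term_zetaMul_of_mem hm, nsmul_eq_mul]
        refine mul_le_mul_of_nonneg_right ?_ (by positivity)
        refine Nat.cast_le.2 (Finset.card_le_card_of_injOn Prod.fst (fun y hy => ?_) ?_)
        · rw [Finset.mem_coe, Finset.mem_filter] at hy
          exact Nat.mem_divisors.2 ⟨⟨_, hy.2.symm⟩, hm.1⟩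
        · intro y hy z hz hyz
          rw [Finset.mem_coe, Finset.mem_filter] at hy hz
          refine Prod.ext hyz (mul_left_cancel₀ (left_ne_zero_of_mul (hy.2.trans_ne hm.1)) ?_)
          rw [hy.2, hyz, hz.2]
    _ ≤ _ := hsum.sum_le_tsum _ fun n _ => re_term_zetaMul_nonneg hχ s n

/-- Rankin's trick with `s = 1 + 1/L`: when `log n ≤ L`, replacing `n⁻¹` by `n^(-s)` costs at most a
factor `e`. -/
theorem exists_sum_splitNumbers_le [NeZero q] (hχ : χ ^ 2 = 1) (hχ1 : χ ≠ 1) :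
    ∃ C : ℝ, 0 ≤ C ∧ ∀ L : ℝ, 1 ≤ L → ∀ T : Finset ℕ,
      (∀ n ∈ T, n ∈ χ.splitNumbers ∧ Real.log n ≤ L) → ∑ n ∈ T, (n : ℝ)⁻¹ ≤ C * √L := by
  obtain ⟨C, hC0, hC⟩ := exists_tsum_re_term_zetaMul_le hχ1
  refine ⟨Real.exp 1 * √C, by positivity, fun L hL T hT => ?_⟩
  have hL0 : 0 < L := by linarith
  have hs : 1 < 1 + L⁻¹ := by simpa using hL0
  have h1 := sq_sum_splitNumbers_le hχ T (fun n hn => (hT n hn).1) hs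
  have h2 := hC (1 + L⁻¹) hs (by linarith [inv_le_one_of_one_le₀ hL])
  rw [add_sub_cancel_left, div_inv_eq_mul] at h2
  have h3 : ∑ n ∈ T, (n : ℝ) ^ (-(1 + L⁻¹)) ≤ √C * √L := by
    rw [← Real.sqrt_mul hC0]
    exact Real.le_sqrt_of_sq_le (h1.trans h2)
  calc ∑ n ∈ T, (n : ℝ)⁻¹ ≤ ∑ n ∈ T, Real.exp 1 * (n : ℝ) ^ (-(1 + L⁻¹)) := by
        refine Finset.sum_le_sum fun n hn => ?_
        have hn0 : (0 : ℝ) < n := by exact_mod_cast Nat.pos_of_ne_zero (hT n hn).1.1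
        rw [neg_add, Real.rpow_add hn0, Real.rpow_neg_one, mul_left_comm]
        refine le_mul_of_one_le_right (by positivity) ?_
        rw [Real.rpow_def_of_pos hn0, ← Real.exp_add]
        refine Real.one_le_exp ?_
        have : Real.log n * L⁻¹ ≤ 1 := by
          rw [← div_eq_mul_inv, div_le_one hL0]; exact (hT n hn).2
        linarith
    _ ≤ _ := by
        rw [← Finset.mul_sum, mul_assoc]
        gcongr

open scoped ArithmeticFunction.vonMangoldt in
/-- An upper bound of the right order of magnitude for the number of split numbers. -/
theorem exists_card_splitNumbers_le [NeZero q] (hχ : χ ^ 2 = 1) (hχ1 : χ ≠ 1) :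
    ∃ C : ℝ, 0 ≤ C ∧ ∀ x : ℝ, 1 ≤ x →
      ((χ.splitNumbers ∩ Set.Icc 1 ⌊x⌋₊).ncard : ℝ) ≤ C * (x / √(1 + Real.log x)) := by
  classical
  obtain ⟨C, hC0, hC⟩ := exists_sum_splitNumbers_le hχ hχ1
  refine ⟨(Real.log 4 + 4 + 1) * C, by positivity, fun x hx => ?_⟩
  have hx0 : 0 < x := by linarith
  set L := 1 + Real.log x with hLdef
  have hL : 1 ≤ L := by linarith [Real.log_nonneg hx]
  set T := (Finset.Ioc 0 ⌊x⌋₊).filter (· ∈ χ.splitNumbers) with hTdef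
  have hcard : (χ.splitNumbers ∩ Set.Icc 1 ⌊x⌋₊).ncard = T.card := by
    rw [← Set.ncard_coe_finset]
    congr 1
    ext n
    simp only [Set.mem_inter_iff, Set.mem_Icc, hTdef, Finset.mem_coe, Finset.mem_filter,
      Finset.mem_Ioc, Nat.lt_iff_add_one_le, zero_add]
    exact and_comm
  have hTpos : ∀ n ∈ T, (0 : ℝ) < n ∧ (n : ℝ) ≤ x := fun n hn => by
    rw [hTdef, Finset.mem_filter, Finset.mem_Ioc] at hn
    exact ⟨by exact_mod_cast hn.1.1, (Nat.le_floor_iff hx0.le).1 hn.1.2⟩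
  have hinv : ∑ n ∈ T, (n : ℝ)⁻¹ ≤ C * √L := by
    refine hC L hL T fun n hn => ⟨(Finset.mem_filter.1 hn).2, ?_⟩
    linarith [Real.log_le_log (hTpos n hn).1 (hTpos n hn).2]
  let f : ArithmeticFunction ℝ := ⟨fun n => if n ∈ χ.splitNumbers then 1 else 0, by
    simp [splitNumbers]⟩
  -- Write `log = 1 * Λ`; divisors of split numbers are split, so `1` may be replaced by the
  -- indicator `f`. Summing over the cofactor gives `ψ(x / n)`.
  have hlog : ∑ n ∈ T, Real.log n ≤ (Real.log 4 + 4) * x * ∑ n ∈ T, (n : ℝ)⁻¹ := by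
    calc ∑ n ∈ T, Real.log n ≤ ∑ n ∈ T, (f * Λ) n := by
          refine Finset.sum_le_sum fun n hn => ?_
          have hn' := (Finset.mem_filter.1 hn).2
          rw [← ArithmeticFunction.log_apply, ← ArithmeticFunction.zeta_mul_vonMangoldt,
            ArithmeticFunction.mul_apply, ArithmeticFunction.mul_apply]
          refine Finset.sum_le_sum fun y hy => ?_
          obtain ⟨hy1, hy2⟩ := Nat.mem_divisorsAntidiagonal.1 hy
          have h1 : y.1 ∈ χ.splitNumbers := mem_splitNumbers_of_dvd hn' ⟨_, hy1.symm⟩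
          simp [f, h1, h1.1]
      _ ≤ ∑ n ∈ Finset.Ioc 0 ⌊x⌋₊, (f * Λ) n := by
          refine Finset.sum_le_sum_of_subset_of_nonneg (Finset.filter_subset _ _) fun n _ _ => ?_
          rw [ArithmeticFunction.mul_apply]
          refine Finset.sum_nonneg fun y _ => mul_nonneg ?_ ArithmeticFunction.vonMangoldt_nonneg
          simp only [f, ArithmeticFunction.coe_mk]
          split_ifs <;> norm_num
      _ = ∑ n ∈ T, Chebyshev.psi ((⌊x⌋₊ / n : ℕ) : ℝ) := by
          rw [ArithmeticFunction.sum_Ioc_mul_eq_sum_sum, hTdef, Finset.sum_filter]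
          refine Finset.sum_congr rfl fun n _ => ?_
          simp [f, Chebyshev.psi]
      _ ≤ ∑ n ∈ T, (Real.log 4 + 4) * x * (n : ℝ)⁻¹ := by
          refine Finset.sum_le_sum fun n hn => ?_
          refine (Chebyshev.psi_le_const_mul_self (Nat.cast_nonneg _)).trans ?_
          rw [mul_assoc, ← div_eq_mul_inv]
          refine mul_le_mul_of_nonneg_left (Nat.cast_div_le.trans ?_) (by positivity)
          have := (hTpos n hn).1
          gcongr
          exact Nat.floor_le hx0.le
      _ = _ := by rw [Finset.mul_sum]
  have hmain : (T.card : ℝ) * L ≤ (Real.log 4 + 4 + 1) * C * x * √L := by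
    -- Termwise this is `1 + log (x / n) ≤ x / n`.
    calc (T.card : ℝ) * L ≤ ∑ n ∈ T, (Real.log n + x * (n : ℝ)⁻¹) := by
          rw [← nsmul_eq_mul]
          refine Finset.card_nsmul_le_sum _ _ _ fun n hn => ?_
          obtain ⟨h0, h1⟩ := hTpos n hn
          have := Real.add_one_le_exp (Real.log (x / n))
          rw [Real.exp_log (by positivity), Real.log_div hx0.ne' h0.ne', div_eq_mul_inv] at this
          linarith
      _ ≤ (Real.log 4 + 4) * x * ∑ n ∈ T, (n : ℝ)⁻¹ + x * ∑ n ∈ T, (n : ℝ)⁻¹ := by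
          rw [Finset.sum_add_distrib, ← Finset.mul_sum]
          linarith
      _ = (Real.log 4 + 4 + 1) * x * ∑ n ∈ T, (n : ℝ)⁻¹ := by ring
      _ ≤ (Real.log 4 + 4 + 1) * x * (C * √L) := by gcongr
      _ = _ := by ring
  have hL0 : 0 < L := by linarith
  have hsq : 0 < √L := Real.sqrt_pos.2 hL0
  rw [hcard, ← mul_div_assoc, le_div_iff₀ hsq]
  refine le_of_mul_le_mul_right ?_ hsq
  rw [mul_assoc, Real.mul_self_sqrt hL0.le]
  exact hmain

end DirichletCharacter

/-! ### The character of `-D` and the values of `u² + D v²`. -/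

/-- By reciprocity, the symbol depends on `n` only modulo `4D`. It is `-1` at `n = 4D - 1`: there
`4D ≡ 1` gives `(D/n) = 1`, while `n ≡ 3 mod 4` gives `(-1/n) = -1`. -/
theorem exists_dirichletCharacter_eq_jacobiSym {D : ℕ} (hD : D ≠ 0) :
    ∃ χ : DirichletCharacter ℂ (4 * D), χ ^ 2 = 1 ∧ χ ≠ 1 ∧
      ∀ n : ℕ, n.Coprime (4 * D) → χ n = (jacobiSym (-D) n : ℂ) := by
  classical
  have : NeZero (4 * D) := ⟨by omega⟩
  have hunit : ∀ n : ℕ, IsUnit (n : ZMod (4 * D)) ↔ n.Coprime (4 * D) := fun n =>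
    ZMod.isUnit_iff_coprime n (4 * D)
  have hodd : ∀ {n : ℕ}, n.Coprime (4 * D) → Odd n := fun {n} h =>
    Nat.coprime_two_right.1 (h.coprime_dvd_right ⟨2 * D, by ring⟩)
  have hmod : ∀ {n : ℕ}, n.Coprime (4 * D) → jacobiSym (-D) (n % (4 * D)) = jacobiSym (-D) n :=
    fun {n} h => by
      have := jacobiSym.mod_right (-D : ℤ) (hodd h)
      rw [this, Int.natAbs_neg, Int.natAbs_natCast]
  let χ : DirichletCharacter ℂ (4 * D) :=
    { toFun := fun a => if IsUnit a then (jacobiSym (-D) a.val : ℂ) else 0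
      map_one' := by
        have h := hmod (n := 1) (Nat.coprime_one_left _)
        rw [if_pos isUnit_one, ZMod.val_one'' (by omega), jacobiSym.one_right, Int.cast_one]
      map_mul' := fun a b => by
        by_cases ha : IsUnit a
        · by_cases hb : IsUnit b
          · have hab : (a.val * b.val).Coprime (4 * D) := by
              rw [← hunit, Nat.cast_mul, ZMod.natCast_zmod_val, ZMod.natCast_zmod_val]
              exact ha.mul hb
            have ha0 : NeZero a.val := ⟨fun h => by simp [h] at hab⟩
            have hb0 : NeZero b.val := ⟨fun h => by simp [h] at hab⟩
            rw [if_pos ha, if_pos hb, if_pos (ha.mul hb), ZMod.val_mul, hmod hab,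
              jacobiSym.mul_right, Int.cast_mul]
          · rw [if_neg hb, if_neg (fun h => hb (isUnit_of_mul_isUnit_right h)), mul_zero]
        · rw [if_neg ha, if_neg (fun h => ha (isUnit_of_mul_isUnit_left h)), zero_mul]
      map_nonunit' := fun a ha => if_neg ha }
  have hχ : ∀ n : ℕ, n.Coprime (4 * D) → χ n = (jacobiSym (-D) n : ℂ) := fun n hn => by
    change (if IsUnit (n : ZMod (4 * D)) then
      (jacobiSym (-D) (n : ZMod (4 * D)).val : ℂ) else 0) = _
    rw [if_pos ((hunit n).2 hn), ZMod.val_natCast, hmod hn]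
  refine ⟨χ, ?_, fun h => ?_, hχ⟩
  · ext a
    have ha : (a : ZMod (4 * D)).val.Coprime (4 * D) := by
      rw [← hunit, ZMod.natCast_zmod_val]; exact a.isUnit
    rw [MulChar.pow_apply_coe, MulChar.one_apply_coe]
    have := hχ _ ha
    rw [ZMod.natCast_zmod_val] at this
    rw [this]
    have hg : (-D : ℤ).gcd ((a : ZMod (4 * D)).val : ℕ) = 1 := by
      rw [Int.neg_gcd, Int.gcd_natCast_natCast]
      exact (ha.coprime_dvd_right ⟨4, by ring⟩).symm
    exact_mod_cast jacobiSym.sq_one hg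
  · have hcop : (4 * D - 1).Coprime (4 * D) := by
      have := Nat.coprime_self_sub_left (m := 1) (n := 4 * D) (by omega)
      rw [this]; exact Nat.coprime_one_left _
    have h1 := hχ _ hcop
    rw [h, MulChar.one_apply ((hunit _).2 hcop)] at h1
    have h2 : jacobiSym (-D) (4 * D - 1) = -1 := by
      have hb := hodd hcop
      have h4 : jacobiSym (D : ℤ) (4 * D - 1) = 1 := by
        have h5 : jacobiSym (2 ^ 2 * D : ℤ) (4 * D - 1) = 1 := by
          have h6 : (2 ^ 2 * D : ℤ) = 1 + (4 * D - 1 : ℕ) := by omega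
          rw [jacobiSym.mod_left' (a₂ := 1) (by rw [h6, Int.add_emod_right]), jacobiSym.one_left]
        have h7 : (2 : ℤ).gcd (4 * D - 1 : ℕ) = 1 := Nat.coprime_two_left.2 hb
        rwa [jacobiSym.mul_left, jacobiSym.sq_one' h7, one_mul] at h5
      rw [jacobiSym.neg _ hb, h4, mul_one, ZMod.χ₄_nat_three_mod_four (by omega)]
    rw [h2] at h1
    norm_num at h1

/-- A positive value of `u² + D v²` is a product of a square, a divisor of `4D` and a split number
of the character of `ℚ(√-D)`. -/
theorem exists_eq_sq_mul_mul_of_eq_sq_add {D : ℕ} {χ : DirichletCharacter ℂ (4 * D)}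
    (hχ : ∀ n : ℕ, n.Coprime (4 * D) → χ n = (jacobiSym (-D) n : ℂ)) {n : ℕ} (hn : n ≠ 0)
    {u v : ℤ} (h : (n : ℤ) = u ^ 2 + D * v ^ 2) :
    ∃ m e r : ℕ, n = m ^ 2 * (e * r) ∧ e ∣ 4 * D ∧ r ∈ χ.splitNumbers := by
  set g := Int.gcd u v with hg
  have hg0 : 0 < g := by
    refine Int.gcd_pos_iff.2 ?_
    by_contra! hc
    rw [hc.1, hc.2] at h
    simp at h
    exact hn h
  obtain ⟨u', v', hcop, hu, hv⟩ := Int.exists_gcd_one hg0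
  have hn' : (n : ℤ) = (g : ℤ) ^ 2 * (u' ^ 2 + D * v' ^ 2) := by
    rw [← hg] at hu hv
    rw [h]
    nth_rewrite 1 [hu, hv]
    ring
  have hdvd : g ^ 2 ∣ n := by
    rw [← Int.natCast_dvd_natCast, hn']; push_cast; exact dvd_mul_right _ _
  obtain ⟨k, hk⟩ := hdvd
  have hkval : (k : ℤ) = u' ^ 2 + D * v' ^ 2 := by
    rw [hk] at hn'
    push_cast at hn'
    exact mul_left_cancel₀ (by positivity) hn'
  -- An inert prime dividing `k` would divide both `u'` and `v'`, which are coprime.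
  have hprime : ∀ p : ℕ, p.Prime → p ∣ k → jacobiSym (-D) p ≠ -1 := fun p hp hpk hj => by
    have : Fact p.Prime := ⟨hp⟩
    have hd : (p : ℤ) ∣ u' ^ 2 - (-D) * v' ^ 2 := by
      rw [neg_mul, sub_neg_eq_add, ← hkval]; exact_mod_cast hpk
    obtain ⟨h1, h2⟩ := jacobiSym.prime_dvd_of_eq_neg_one hj hd
    have := Int.dvd_coe_gcd h1 h2
    rw [hcop] at this
    exact hp.one_lt.ne' (by exact_mod_cast Int.eq_one_of_dvd_one (by positivity) this)
  obtain ⟨a, b, hab, hsq⟩ := Nat.sq_mul_squarefree k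
  have ha0 : a ≠ 0 := hsq.ne_zero
  -- Since `a` is squarefree, removing `e` leaves a cofactor prime to `4D`.
  set e := a.gcd (4 * D) with he
  obtain ⟨r, hr⟩ : e ∣ a := Nat.gcd_dvd_left _ _
  have hr0 : r ≠ 0 := fun h0 => ha0 (by rw [hr, h0, mul_zero])
  refine ⟨g * b, e, r, by rw [hk, ← hab, hr]; ring, Nat.gcd_dvd_right _ _,
    DirichletCharacter.mem_splitNumbers_of_primes hr0 fun p hp hpr => ?_⟩
  have hpa : p ∣ a := hr ▸ hpr.mul_left e
  have hpcop : p.Coprime (4 * D) := by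
    rw [hp.coprime_iff_not_dvd]
    intro hpD
    have hpe : p ∣ e := Nat.dvd_gcd hpa hpD
    refine hp.one_lt.ne' (Nat.isUnit_iff.1 (hsq p ?_))
    rw [hr]; exact mul_dvd_mul hpe hpr
  rw [hχ p hpcop]
  have hgcd : (-D : ℤ).gcd p = 1 := by
    rw [Int.neg_gcd, Int.gcd_natCast_natCast]
    exact (hpcop.coprime_dvd_right ⟨4, by ring⟩).symm
  rcases jacobiSym.eq_one_or_neg_one hgcd with h1 | h1
  · rw [h1, Int.cast_one]
  · exact absurd h1 (hprime p hp (hab ▸ hpa.mul_left _))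

/-- `O(N / √log N)` positive integers up to `N` are of the form `u² + D v²`. -/
theorem exists_ncard_sq_add_le {D : ℕ} (hD : D ≠ 0) :
    ∃ C : ℝ, 0 ≤ C ∧ ∀ N : ℕ, 1 ≤ N →
      ({n : ℕ | n ∈ Set.Icc 1 N ∧ ∃ u v : ℤ, (n : ℤ) = u ^ 2 + D * v ^ 2}.ncard : ℝ) ≤
        C * (N / √(1 + Real.log N)) := by
  classical
  have : NeZero (4 * D) := ⟨by omega⟩
  obtain ⟨χ, hχ2, hχ1, hχ⟩ := exists_dirichletCharacter_eq_jacobiSym hD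
  obtain ⟨C, hC0, hC⟩ := DirichletCharacter.exists_card_splitNumbers_le hχ2 hχ1
  set Z : ℝ := ∑' m : ℕ, (m : ℝ) ^ (-(3 / 2) : ℝ) with hZ
  have hsum : Summable fun m : ℕ => (m : ℝ) ^ (-(3 / 2) : ℝ) :=
    Real.summable_nat_rpow.2 (by norm_num)
  have hZ0 : 0 ≤ Z := tsum_nonneg fun m => by positivity
  refine ⟨(4 * D).divisors.card * (C * √2 * Z), by positivity, fun N hN => ?_⟩
  let S : ℕ → Set ℕ := fun m => χ.splitNumbers ∩ Set.Icc 1 ⌊(N : ℝ) / m ^ 2⌋₊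
  have hSfin : ∀ m, (S m).Finite := fun m => (Set.finite_Icc _ _).inter_of_right _
  have hN0 : (0 : ℝ) < N := by exact_mod_cast hN
  have hlogN : 0 ≤ Real.log N := Real.log_natCast_nonneg N
  have hSle : ∀ m ∈ Finset.Icc 1 N,
      ((S m).ncard : ℝ) ≤ C * √2 * (N / √(1 + Real.log N)) * (m : ℝ) ^ (-(3 / 2) : ℝ) := by
    intro m hm
    have hm1 : (1 : ℝ) ≤ m := by exact_mod_cast (Finset.mem_Icc.1 hm).1
    have hm0 : (0 : ℝ) < m := by linarith
    rcases lt_or_ge ((N : ℝ) / m ^ 2) 1 with hlt | hge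
    · have : S m = ∅ := by
        simp only [S, Nat.floor_eq_zero.2 hlt]
        rw [Set.Icc_eq_empty (by norm_num), Set.inter_empty]
      rw [this, Set.ncard_empty, Nat.cast_zero]
      positivity
    · refine (hC _ hge).trans ?_
      set y := (N : ℝ) / m ^ 2 with hy
      have hly : 0 ≤ Real.log y := Real.log_nonneg hge
      -- Passing from `log y` to `log N` costs only `√(2m)`; against `m⁻²` this leaves the summable
      -- `m^(-3/2)`.
      have hlog : 1 + Real.log N ≤ (1 + Real.log y) * (2 * m) := by
        have h1 : Real.log N = Real.log y + 2 * Real.log m := by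
          rw [hy, Real.log_div hN0.ne' (by positivity), Real.log_pow]; push_cast; ring
        have h2 := Real.log_le_sub_one_of_pos hm0
        nlinarith
      have hsq : √(1 + Real.log N) ≤ √(1 + Real.log y) * (√2 * √m) := by
        rw [← Real.sqrt_mul (by norm_num), ← Real.sqrt_mul (by linarith)]
        exact Real.sqrt_le_sqrt hlog
      have hp1 : 0 < √(1 + Real.log N) := Real.sqrt_pos.2 (by linarith)
      have hp2 : 0 < √(1 + Real.log y) := Real.sqrt_pos.2 (by linarith)
      have hm32 : (m : ℝ) ^ (-(3 / 2) : ℝ) = √m / m ^ 2 := by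
        rw [Real.sqrt_eq_rpow, ← Real.rpow_natCast, ← Real.rpow_sub hm0]; norm_num
      rw [hm32, mul_assoc C, mul_assoc C]
      refine mul_le_mul_of_nonneg_left ?_ hC0
      calc y / √(1 + Real.log y)
          ≤ y * (√2 * √m / √(1 + Real.log N)) := by
            rw [div_eq_mul_inv]
            refine mul_le_mul_of_nonneg_left ?_ (by linarith)
            rw [inv_le_comm₀ hp2 (by positivity), inv_div, div_le_iff₀ (by positivity)]
            exact hsq
        _ = _ := by rw [hy]; ring
  set R := {n : ℕ | n ∈ Set.Icc 1 N ∧ ∃ u v : ℤ, (n : ℤ) = u ^ 2 + D * v ^ 2} with hR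
  let U : Finset ℕ := (4 * D).divisors.biUnion fun e => (Finset.Icc 1 N).biUnion fun m =>
    (hSfin m).toFinset.image fun r => m ^ 2 * (e * r)
  have hRU : R ⊆ U := by
    rintro n ⟨⟨h1, hnN⟩, u, v, huv⟩
    obtain ⟨m, e, r, rfl, he, hr⟩ := exists_eq_sq_mul_mul_of_eq_sq_add hχ (by omega) huv
    have hm0 : 0 < m := Nat.pos_of_ne_zero fun h => by simp [h] at h1
    have he0 : 0 < e := Nat.pos_of_ne_zero fun h => by simp [h] at h1
    have hr0 : 0 < r := Nat.pos_of_ne_zero hr.1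
    have hmr : m ^ 2 * r ≤ N := le_trans (by gcongr; exact Nat.le_mul_of_pos_left r he0) hnN
    simp only [U, Finset.coe_biUnion, Set.mem_iUnion, Finset.mem_coe, Finset.mem_image,
      Set.Finite.mem_toFinset]
    refine ⟨e, Nat.mem_divisors.2 ⟨he, NeZero.ne _⟩, m, Finset.mem_Icc.2 ⟨hm0, ?_⟩, r,
      ⟨hr, hr0, Nat.le_floor ?_⟩, rfl⟩
    · nlinarith
    · rw [le_div_iff₀ (by positivity), mul_comm]
      exact_mod_cast hmr
  have hcard : R.ncard ≤ ∑ _e ∈ (4 * D).divisors, ∑ m ∈ Finset.Icc 1 N, (S m).ncard := by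
    calc R.ncard ≤ U.card := by
          rw [← Set.ncard_coe_finset]; exact Set.ncard_le_ncard hRU
      _ ≤ _ := by
        refine Finset.card_biUnion_le.trans (Finset.sum_le_sum fun e _ => ?_)
        refine Finset.card_biUnion_le.trans (Finset.sum_le_sum fun m _ => ?_)
        rw [Set.ncard_eq_toFinset_card _ (hSfin m)]
        exact Finset.card_image_le
  calc (R.ncard : ℝ) ≤ ∑ _e ∈ (4 * D).divisors, ∑ m ∈ Finset.Icc 1 N, ((S m).ncard : ℝ) := by
        exact_mod_cast hcard
    _ ≤ ∑ _e ∈ (4 * D).divisors, C * √2 * (N / √(1 + Real.log N)) * Z := by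
        refine Finset.sum_le_sum fun e _ => (Finset.sum_le_sum hSle).trans ?_
        rw [← Finset.mul_sum]
        exact mul_le_mul_of_nonneg_left (hsum.sum_le_tsum _ fun m _ => by positivity)
          (by positivity)
    _ = _ := by rw [Finset.sum_const, nsmul_eq_mul]; ring

/-! ### Explicit coefficients of `Q`, and clearing denominators. -/

namespace MvPolynomial

/-- The exponents of the monomials of degree at most two in two variables. -/
theorem mem_support_of_totalDegree_le_two {R : Type*} [CommSemiring R] {Q : MvPolynomial (Fin 2) R}
    (hQ : Q.totalDegree ≤ 2) {m : Fin 2 →₀ ℕ} (hm : m ∈ Q.support) :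
    (m 0, m 1) ∈ ({(0, 0), (1, 0), (0, 1), (2, 0), (1, 1), (0, 2)} : Finset (ℕ × ℕ)) := by
  have h := (le_totalDegree hm).trans hQ
  rw [Finsupp.sum_fintype _ _ fun _ => rfl, Fin.sum_univ_two] at h
  have h0 : m 0 ≤ 2 := by omega
  have h1 : m 1 ≤ 2 := by omega
  generalize m 0 = i at *
  generalize m 1 = j at *
  interval_cases i <;> interval_cases j <;> first | omega | decide

theorem finTwo_exponent_eq (m : Fin 2 →₀ ℕ) :
    Finsupp.single 0 (m 0) + Finsupp.single 1 (m 1) = m := by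
  ext i
  fin_cases i <;> simp

/-- The explicit form of a polynomial of degree two in two variables. -/
theorem exists_eval_eq_of_totalDegree_eq_two {R : Type*} [CommSemiring R]
    {Q : MvPolynomial (Fin 2) R} (hQ : Q.totalDegree = 2) :
    ∃ a b c d e f : R, (a ≠ 0 ∨ b ≠ 0 ∨ c ≠ 0) ∧
      ∀ x y : R, eval ![x, y] Q = a * x ^ 2 + b * x * y + c * y ^ 2 + d * x + e * y + f := by
  classical
  let g : ℕ × ℕ → (Fin 2 →₀ ℕ) := fun t => Finsupp.single 0 t.1 + Finsupp.single 1 t.2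
  have hg : Function.Injective g := fun s t h => by
    have h0 := DFunLike.congr_fun h 0
    have h1 := DFunLike.congr_fun h 1
    simp [g] at h0 h1
    exact Prod.ext h0 h1
  refine ⟨Q.coeff (g (2, 0)), Q.coeff (g (1, 1)), Q.coeff (g (0, 2)), Q.coeff (g (1, 0)),
    Q.coeff (g (0, 1)), Q.coeff (g (0, 0)), ?_, fun x y => ?_⟩
  · by_contra! hc
    have : Q.totalDegree ≤ 1 := by
      refine Finset.sup_le fun m hm => ?_
      have hmem := mem_support_of_totalDegree_le_two hQ.le hm
      rw [mem_support_iff, ← finTwo_exponent_eq m] at hm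
      rw [Finsupp.sum_fintype _ _ fun _ => rfl, Fin.sum_univ_two]
      simp only [g] at hc
      generalize m 0 = i at *
      generalize m 1 = j at *
      simp only [Finset.mem_insert, Finset.mem_singleton, Prod.mk.injEq] at hmem
      rcases hmem with ⟨rfl, rfl⟩ | ⟨rfl, rfl⟩ | ⟨rfl, rfl⟩ | ⟨rfl, rfl⟩ | ⟨rfl, rfl⟩ | ⟨rfl, rfl⟩
      · norm_num
      · norm_num
      · norm_num
      · exact absurd hc.1 hm
      · exact absurd hc.2.1 hm
      · exact absurd hc.2.2 hm
    omega
  · rw [eval_eq', Finset.sum_subset (s₂ := Finset.image g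
      {(0, 0), (1, 0), (0, 1), (2, 0), (1, 1), (0, 2)}), Finset.sum_image hg.injOn]
    · simp [g]
      ring
    · intro m hm
      exact Finset.mem_image.2 ⟨_, mem_support_of_totalDegree_le_two hQ.le hm, finTwo_exponent_eq m⟩
    · intro m _ hm
      rw [notMem_support_iff.1 hm, zero_mul]

end MvPolynomial

theorem exists_int_coeffs_of_totalDegree_eq_two {Q : MvPolynomial (Fin 2) ℚ}
    (hQ : Q.totalDegree = 2) :
    ∃ k : ℤ, 0 < k ∧ ∃ a b c d e f : ℤ, (a ≠ 0 ∨ b ≠ 0 ∨ c ≠ 0) ∧ ∀ x y : ℤ,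
      (k : ℝ) * valueAt Q (x, y) =
        (a * x ^ 2 + b * x * y + c * y ^ 2 + d * x + e * y + f : ℤ) := by
  classical
  obtain ⟨a, b, c, d, e, f, h0, h⟩ := MvPolynomial.exists_eval_eq_of_totalDegree_eq_two hQ
  obtain ⟨⟨k, hk⟩, hz⟩ := IsLocalization.exist_integer_multiples_of_finset (nonZeroDivisors ℤ)
    ({a, b, c, d, e, f} : Finset ℚ)
  have hk0 : k ≠ 0 := nonZeroDivisors.ne_zero hk
  have hz' : ∀ t ∈ ({a, b, c, d, e, f} : Finset ℚ), ∃ z : ℤ, ((|k| : ℤ) : ℚ) * t = z := by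
    intro t ht
    obtain ⟨z, hz⟩ := hz t ht
    simp at hz
    rcases abs_choice k with h | h
    · exact ⟨z, by rw [h, hz]⟩
    · exact ⟨-z, by rw [h]; push_cast; rw [hz]; ring⟩
  obtain ⟨a', ha⟩ := hz' a (by simp)
  obtain ⟨b', hb⟩ := hz' b (by simp)
  obtain ⟨c', hc⟩ := hz' c (by simp)
  obtain ⟨d', hd⟩ := hz' d (by simp)
  obtain ⟨e', he⟩ := hz' e (by simp)
  obtain ⟨f', hf⟩ := hz' f (by simp)
  have hkq : ((|k| : ℤ) : ℚ) ≠ 0 := by exact_mod_cast (abs_pos.2 hk0).ne'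
  have hne : ∀ {t : ℚ} {z : ℤ}, ((|k| : ℤ) : ℚ) * t = z → t ≠ 0 → z ≠ 0 := fun h1 h2 h3 => by
    rw [h3, Int.cast_zero] at h1
    exact mul_ne_zero hkq h2 h1
  refine ⟨|k|, abs_pos.2 hk0, a', b', c', d', e', f',
    h0.imp (hne ha) (Or.imp (hne hb) (hne hc)), fun x y => ?_⟩
  have : ((|k| : ℤ) : ℚ) * MvPolynomial.eval ![(x : ℚ), (y : ℚ)] Q =
      (a' * x ^ 2 + b' * x * y + c' * y ^ 2 + d' * x + e' * y + f' : ℤ) := by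
    rw [h]
    push_cast
    rw [← ha, ← hb, ← hc, ← hd, ← he, ← hf]
    push_cast
    ring
  rw [valueAt]
  exact_mod_cast this

/-! ### Completing the square, or descending along a line. -/

theorem exists_quadratic_lt {α β : ℤ} (γ : ℤ) (h : α < 0 ∨ α = 0 ∧ β ≠ 0) (M : ℤ) :
    ∃ t : ℤ, α * t ^ 2 + β * t + γ < M := by
  -- The witness is `±T`, with the sign making the linear term non-positive.
  set T := |γ| + |M| + 1 with hT
  have h1 : 1 ≤ T := by linarith [abs_nonneg γ, abs_nonneg M]
  have hγ := le_abs_self γ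
  have hM := neg_abs_le M
  have hTT : T ≤ T ^ 2 := by nlinarith
  rcases le_or_gt β 0 with hβ | hβ
  · refine ⟨T, ?_⟩
    rcases h with h | ⟨rfl, h⟩
    · nlinarith [mul_nonneg (neg_nonneg.2 hβ) (zero_le_one.trans h1)]
    · have : β < 0 := lt_of_le_of_ne hβ h
      nlinarith
  · refine ⟨-T, ?_⟩
    rcases h with h | ⟨rfl, h⟩
    · nlinarith [mul_nonneg hβ.le (zero_le_one.trans h1)]
    · nlinarith

/-- A quadratic polynomial with nonzero coefficient `a` is, up to an affine change, of the shape
`u² + D v²` with `D > 0`, or is unbounded below. -/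
theorem exists_sq_add_or_unbounded_of_ne_zero {a : ℤ} (ha : a ≠ 0) (b c d e f : ℤ) :
    (∃ K : ℤ, 0 < K ∧ ∃ c₀ : ℤ, ∃ D : ℕ, D ≠ 0 ∧ ∀ x y : ℤ, ∃ u v : ℤ,
      K * (a * x ^ 2 + b * x * y + c * y ^ 2 + d * x + e * y + f) + c₀ = u ^ 2 + D * v ^ 2) ∨
    ∀ M : ℤ, ∃ x y : ℤ, a * x ^ 2 + b * x * y + c * y ^ 2 + d * x + e * y + f < M := by
  have hline : ∀ X Y : ℤ, a * X ^ 2 + b * X * Y + c * Y ^ 2 < 0 ∨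
      a * X ^ 2 + b * X * Y + c * Y ^ 2 = 0 ∧ d * X + e * Y ≠ 0 →
      ∀ M : ℤ, ∃ x y : ℤ, a * x ^ 2 + b * x * y + c * y ^ 2 + d * x + e * y + f < M :=
    fun X Y h M => by
      obtain ⟨t, ht⟩ := exists_quadratic_lt f h M
      exact ⟨t * X, t * Y, by linarith⟩
  rcases ha.lt_or_gt with ha | ha
  · exact Or.inr (hline 1 0 (Or.inl (by linarith)))
  -- The direction `(-b, 2a)` kills `2a x + b y`, so it detects the sign of `4ac - b²`.
  have hform : a * (-b) ^ 2 + b * (-b) * (2 * a) + c * (2 * a) ^ 2 = a * (4 * a * c - b ^ 2) := by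
    ring
  rcases lt_trichotomy (4 * a * c - b ^ 2) 0 with hΔ | hΔ | hΔ
  · exact Or.inr (hline (-b) (2 * a) (Or.inl (by rw [hform]; exact mul_neg_of_pos_of_neg ha hΔ)))
  · by_cases hh : d * (-b) + e * (2 * a) = 0
    -- Here the polynomial depends on one linear form only, so a single square remains and `D = 1`,
    -- `v = 0` are fillers.
    · refine Or.inl ⟨4 * a, by linarith, d ^ 2 - 4 * a * f, 1, one_ne_zero, fun x y =>
        ⟨2 * a * x + b * y + d, 0, ?_⟩⟩
      linear_combination y ^ 2 * hΔ + 2 * y * hh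
    · exact Or.inr (hline (-b) (2 * a) (Or.inr ⟨by rw [hform, hΔ, mul_zero], hh⟩))
  · obtain ⟨D, hD⟩ := Int.eq_ofNat_of_zero_le hΔ.le
    have hD0 : (0 : ℤ) < D := by omega
    -- The extra factor `D = 4ac - b²` allows the square in `y` to be completed over `ℤ`.
    refine Or.inl ⟨4 * a * D, by positivity,
      (d ^ 2 - 4 * a * f) * D + (2 * a * e - b * d) ^ 2, D, by omega, fun x y =>
        ⟨D * y + (2 * a * e - b * d), 2 * a * x + b * y + d, ?_⟩⟩
    linear_combination D * y ^ 2 * hD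

theorem exists_sq_add_or_unbounded {a b c : ℤ} (h : a ≠ 0 ∨ b ≠ 0 ∨ c ≠ 0) (d e f : ℤ) :
    (∃ K : ℤ, 0 < K ∧ ∃ c₀ : ℤ, ∃ D : ℕ, D ≠ 0 ∧ ∀ x y : ℤ, ∃ u v : ℤ,
      K * (a * x ^ 2 + b * x * y + c * y ^ 2 + d * x + e * y + f) + c₀ = u ^ 2 + D * v ^ 2) ∨
    ∀ M : ℤ, ∃ x y : ℤ, a * x ^ 2 + b * x * y + c * y ^ 2 + d * x + e * y + f < M := by
  by_cases ha : a = 0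
  · by_cases hc : c = 0
    · have hb : b ≠ 0 := by tauto
      refine Or.inr fun M => ?_
      -- On the line `y = -b x` the term `b x y` becomes `-b² x²`.
      obtain ⟨t, ht⟩ := exists_quadratic_lt (α := -b ^ 2) (β := d + e * (-b)) f
        (Or.inl (by have := sq_pos_of_ne_zero hb; linarith)) M
      exact ⟨t, -b * t, by rw [ha, hc]; linarith⟩
    · have hswap : ∀ x y : ℤ, a * x ^ 2 + b * x * y + c * y ^ 2 + d * x + e * y + f =
          c * y ^ 2 + b * y * x + a * x ^ 2 + e * y + d * x + f := fun x y => by ring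
      simp only [hswap]
      rcases exists_sq_add_or_unbounded_of_ne_zero hc b a e d f with
        ⟨K, hK, c₀, D, hD, H⟩ | H
      · exact Or.inl ⟨K, hK, c₀, D, hD, fun x y => H y x⟩
      · exact Or.inr fun M => by
          obtain ⟨x, y, hxy⟩ := H M
          exact ⟨y, x, hxy⟩
  · exact exists_sq_add_or_unbounded_of_ne_zero ha b c d e f

/-! ### From the norm form back to the values of `Q`. -/

theorem iInf_valueAt_eq_bot {Q : MvPolynomial (Fin 2) ℚ}
    (h : ∀ M : ℝ, ∃ p, valueAt Q p < M) : (⨅ p : ℤ × ℤ, ((valueAt Q p : ℝ) : EReal)) = ⊥ := by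
  rw [iInf_eq_bot]
  intro b hb
  obtain ⟨r, -, hr⟩ := EReal.lt_iff_exists_real_btwn.1 hb
  obtain ⟨p, hp⟩ := h r
  exact ⟨p, (EReal.coe_lt_coe_iff.2 hp).trans hr⟩

/-- If the values of `Q` are, up to an affine change, of the form `u² + D v²` with `D > 0`, then
`Q` has `O(N / √log N)` values in `[N, 2N]`. -/
theorem isBigO_ncard_valuesIn {Q : MvPolynomial (Fin 2) ℚ} {K c : ℤ} (hK : 0 < K) {D : ℕ}
    (hD : D ≠ 0) (h : ∀ p, ∃ u v : ℤ, (K : ℝ) * valueAt Q p + c = (u ^ 2 + D * v ^ 2 : ℤ)) :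
    (fun N : ℕ => ((valuesIn Q (Set.Icc (N : ℝ) (2 * (N : ℝ)))).ncard : ℝ)) =O[atTop]
      (fun N : ℕ => (N : ℝ) / Real.sqrt (Real.log (N : ℝ))) := by
  obtain ⟨C, hC0, hC⟩ := exists_ncard_sq_add_le hD
  -- For `r ≤ 2N` and `N ≥ 1`, `K r + c ≤ M N`.
  obtain ⟨M, hM⟩ := Int.eq_ofNat_of_zero_le (a := 2 * K + |c|) (by positivity)
  have hM1 : 1 ≤ M := by
    have := abs_nonneg c
    omega
  have hK' : (0 : ℝ) < K := by exact_mod_cast hK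
  -- The `1` pays for the value `0` of the form, which `R` omits.
  refine IsBigO.of_bound (1 + C * M) ?_
  filter_upwards [eventually_ge_atTop 2] with N hN
  have hN2 : (2 : ℝ) ≤ N := by exact_mod_cast hN
  have hlog : 0 < Real.log N := Real.log_pos (by linarith)
  have hMN : 1 ≤ M * N := Nat.mul_pos hM1 (by omega)
  set R := {n : ℕ | n ∈ Set.Icc 1 (M * N) ∧ ∃ u v : ℤ, (n : ℤ) = u ^ 2 + D * v ^ 2} with hR
  have hRfin : R.Finite := (Set.finite_Icc 1 (M * N)).subset fun n hn => hn.1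
  have hnat : ∀ p, ∃ n : ℕ, (K : ℝ) * valueAt Q p + c = n ∧
      ∃ u v : ℤ, (n : ℤ) = u ^ 2 + D * v ^ 2 := fun p => by
    obtain ⟨u, v, huv⟩ := h p
    obtain ⟨n, hn⟩ := Int.eq_ofNat_of_zero_le (a := u ^ 2 + D * v ^ 2) (by positivity)
    exact ⟨n, by rw [huv, hn]; simp, u, v, hn.symm⟩
  have hcard : (valuesIn Q (Set.Icc (N : ℝ) (2 * N))).ncard ≤ (insert 0 R).ncard := by
    refine Set.ncard_le_ncard_of_injOn (fun r => ⌊(K : ℝ) * r + c⌋₊) ?_ ?_ (hRfin.insert 0)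
    · rintro _ ⟨⟨p, rfl⟩, -, h2⟩
      obtain ⟨n, hn, huv⟩ := hnat p
      simp only [hn, Nat.floor_natCast]
      rcases Nat.eq_zero_or_pos n with h0 | h0
      · exact Or.inl h0
      · refine Or.inr ⟨⟨h0, ?_⟩, huv⟩
        have hMr : (M : ℝ) = 2 * K + |(c : ℝ)| := by exact_mod_cast hM.symm
        have : (n : ℝ) ≤ (M * N : ℕ) := by
          rw [← hn, Nat.cast_mul, hMr]
          nlinarith [le_abs_self (c : ℝ), abs_nonneg (c : ℝ)]
        exact_mod_cast this
    · rintro _ ⟨⟨p, rfl⟩, -⟩ _ ⟨⟨p', rfl⟩, -⟩ hpp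
      obtain ⟨n, hn, -⟩ := hnat p
      obtain ⟨n', hn', -⟩ := hnat p'
      simp only [hn, hn', Nat.floor_natCast] at hpp
      rw [hpp, ← hn'] at hn
      exact mul_left_cancel₀ hK'.ne' (add_right_cancel hn)
  have hone : 1 ≤ (N : ℝ) / √(Real.log N) := by
    rw [one_le_div (Real.sqrt_pos.2 hlog)]
    refine Real.sqrt_le_iff.2 ⟨by linarith, ?_⟩
    nlinarith [Real.log_le_sub_one_of_pos (show (0 : ℝ) < N by linarith)]
  have hcount : (R.ncard : ℝ) ≤ C * M * ((N : ℝ) / √(Real.log N)) := by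
    refine (hC (M * N) hMN).trans ?_
    rw [mul_assoc]
    refine mul_le_mul_of_nonneg_left ?_ hC0
    push_cast
    rw [← mul_div_assoc]
    refine div_le_div_of_nonneg_left (by positivity) (Real.sqrt_pos.2 hlog)
      (Real.sqrt_le_sqrt ?_)
    have hM1' : (1 : ℝ) ≤ M := by exact_mod_cast hM1
    have := Real.log_le_log (show (0 : ℝ) < N by linarith)
      (show (N : ℝ) ≤ M * N by nlinarith)
    linarith
  rw [Real.norm_of_nonneg (Nat.cast_nonneg _), Real.norm_of_nonneg (by positivity)]
  calc ((valuesIn Q (Set.Icc (N : ℝ) (2 * N))).ncard : ℝ) ≤ (insert 0 R).ncard := by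
        exact_mod_cast hcard
    _ ≤ R.ncard + 1 := by exact_mod_cast Set.ncard_insert_le 0 R
    _ ≤ _ := by linarith

/-- If every non-negative integer is a value of `F`, then `F` has more than `O(N / √log N)` values
in `[N, 2N]`. -/
theorem not_isBigO_ncard_valuesIn {F : MvPolynomial (Fin 2) ℚ}
    (h : ∀ n : ℕ, (n : ℝ) ∈ valueSet F) :
    ¬ (fun N : ℕ => ((valuesIn F (Set.Icc (N : ℝ) (2 * (N : ℝ)))).ncard : ℝ)) =O[atTop]
      (fun N : ℕ => (N : ℝ) / Real.sqrt (Real.log (N : ℝ))) := fun hO => by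
  obtain ⟨C, hC⟩ := hO.bound
  have hlim : Tendsto (fun N : ℕ => √(Real.log N)) atTop atTop :=
    Real.tendsto_sqrt_atTop.comp (Real.tendsto_log_atTop.comp tendsto_natCast_atTop_atTop)
  -- `[N, 2N]` contains at least `N` integers, so the bound would force `√log N ≤ C`.
  obtain ⟨N, hN, hCN, hN1⟩ := (hC.and ((hlim.eventually_gt_atTop (max C 0)).and
    (eventually_ge_atTop 1))).exists
  have hs : 0 < √(Real.log N) := (le_max_right _ _).trans_lt hCN
  have hN0 : (0 : ℝ) < N := by exact_mod_cast hN1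
  have hcard : N ≤ (valuesIn F (Set.Icc (N : ℝ) (2 * N))).ncard := by
    calc N ≤ ((fun n : ℕ => (n : ℝ)) '' Set.Icc N (2 * N)).ncard := by
          rw [Set.ncard_image_of_injective _ Nat.cast_injective, ← Finset.coe_Icc,
            Set.ncard_coe_finset, Nat.card_Icc]
          omega
      _ ≤ _ := Set.ncard_le_ncard (by
          rintro _ ⟨n, hn, rfl⟩
          exact ⟨h n, Nat.cast_le.2 hn.1, by simpa using Nat.cast_le (α := ℝ).2 hn.2⟩) (valuesIn_Icc_finite F _ _)
  rw [Real.norm_of_nonneg (Nat.cast_nonneg _), Real.norm_of_nonneg (by positivity)] at hN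
  have h1 : (N : ℝ) ≤ C * (N / √(Real.log N)) := le_trans (by exact_mod_cast hcard) hN
  rw [← mul_div_assoc, le_div_iff₀ hs] at h1
  nlinarith [(le_max_left C 0).trans_lt hCN]

theorem corollary5p3 (Q : MvPolynomial (Fin 2) ℚ) (hQ : Q.totalDegree = 2) :
    ((fun N : ℕ => ((valuesIn Q (Set.Icc (N : ℝ) (2 * (N : ℝ)))).ncard : ℝ)) =O[atTop]
          (fun N : ℕ => (N : ℝ) / Real.sqrt (Real.log (N : ℝ))) ∨
        (⨅ p : ℤ × ℤ, ((valueAt Q p : ℝ) : EReal)) = ⊥) ∧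
      valueSet Q ≠ {r : ℝ | ∃ n : ℕ, r = (n : ℝ)} := by
  have hmain : (fun N : ℕ => ((valuesIn Q (Set.Icc (N : ℝ) (2 * (N : ℝ)))).ncard : ℝ)) =O[atTop]
      (fun N : ℕ => (N : ℝ) / Real.sqrt (Real.log (N : ℝ))) ∨ ∀ M : ℝ, ∃ p, valueAt Q p < M := by
    obtain ⟨k, hk, a, b, c, d, e, f, h0, h⟩ := exists_int_coeffs_of_totalDegree_eq_two hQ
    have hk' : (0 : ℝ) < k := by exact_mod_cast hk
    rcases exists_sq_add_or_unbounded h0 d e f with ⟨K, hK, c₀, D, hD, H⟩ | H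
    · refine Or.inl (isBigO_ncard_valuesIn (K := K * k) (c := c₀) (mul_pos hK hk) hD fun p => ?_)
      obtain ⟨u, v, huv⟩ := H p.1 p.2
      refine ⟨u, v, ?_⟩
      rw [← huv, Int.cast_mul, mul_assoc, h p.1 p.2]
      push_cast
      ring
    · refine Or.inr fun M => ?_
      obtain ⟨x, y, hxy⟩ := H ⌊k * M⌋
      refine ⟨(x, y), lt_of_mul_lt_mul_left ?_ hk'.le⟩
      rw [h x y]
      exact (Int.cast_lt.2 hxy).trans_le (Int.floor_le _)
  refine ⟨hmain.imp_right iInf_valueAt_eq_bot, fun heq => ?_⟩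
  rcases hmain with hO | hb
  · exact not_isBigO_ncard_valuesIn (fun n => heq ▸ ⟨n, rfl⟩) hO
  · obtain ⟨p, hp⟩ := hb 0
    obtain ⟨n, hn⟩ : valueAt Q p ∈ {r : ℝ | ∃ n : ℕ, r = (n : ℝ)} := heq ▸ ⟨p, rfl⟩
    rw [hn] at hp
    exact absurd hp (not_lt.2 n.cast_nonneg)
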